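/- Let $z$ be an indeterminate and, for $k\ge 1$, let $\mathcal A_k(z)$ be the partition algebra: the free $\mathbb Z[z]$-module on the set partitions of $\{1,\dots,k,1',\dots,k'\}$ (drawn as diagrams with top row $1,\dots,k$ and bottom row $1',\dots,k'$), with product $\rho_1\rho_2=z^{\ell}\,\rho_1\circ\rho_2$, where $\rho_1\circ\rho_2$ is obtained by placing $\rho_1$ above $\rho_2$, identifying the bottom row of $\rho_1$ with the top row of $\rho_2$ and restricting to the outer rows, and $\ell$ is the number of blocks lying entirely in the middle row. Let $s_i$ ($1\le i<k$) be the diagram with blocks $\{i,(i+1)'\},\{i+1,i'\}$ and $\{j,j'\}$ for $j\ne i,i+1$; let $p_i$ ($1\le i\le k$) be the diagram with blocks $\{i\},\{i'\}$ and $\{j,j'\}$ for $j\neq i$; let $p_{i+\frac12}$ ($1\le i<k$) be the diagram with blocks $\{i,i+1,i',(i+1)'\}$ and $\{j,j'\}$ for $j\ne i,i+1$. Define recursively $L_0=0$, $L_1=p_1$, $\sigma_1=1$, $\sigma_2=s_1$, and $$L_{i+1}=-s_iL_ip_{i+\frac12}-p_{i+\frac12}L_is_i+p_{i+\frac12}L_ip_{i+1}p_{i+\frac12}+s_iL_is_i+\sigma_{i+1}\qquad(i\ge1),$$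 $$\begin{aligned}\sigma_{i+1}={}&s_{i-1}s_i\sigma_is_is_{i-1}+s_ip_{i-\frac12}L_{i-1}s_ip_{i-\frac12}s_i+p_{i-\frac12}L_{i-1}s_ip_{i-\frac12}\\&-s_ip_{i-\frac12}L_{i-1}s_{i-1}p_{i+\frac12}p_ip_{i-\frac12}-p_{i-\frac12}p_ip_{i+\frac12}s_{i-1}L_{i-1}p_{i-\frac12}s_i\qquad(i\ge2);\end{aligned}$$ and $\sigma_{\frac12}=\sigma_{1+\frac12}=1$ and, for $i\ge2$, $$\begin{aligned}\sigma_{i+\frac12}={}&s_{i-1}s_i\sigma_{i-\frac12}s_is_{i-1}+p_{i-\frac12}L_{i-1}s_ip_{i-\frac12}s_i+s_ip_{i-\frac12}L_{i-1}s_ip_{i-\frac12}\\&-p_{i-\frac12}L_{i-1}s_{i-1}p_{i+\frac12}p_ip_{i-\frac12}-s_ip_{i-\frac12}p_ip_{i+\frac12}s_{i-1}L_{i-1}p_{i-\frac12}s_i.\end{aligned}$$ Then, in $\mathcal A_k(z)$ for every $k\ge i+1$: 1. $\sigma_{i+1}p_{i-\frac12}=p_{i-\frac12}\sigma_{i+1}=p_{i-\frac12}L_{i-1}s_ip_{i-\frac12}$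 for $i\ge2$; 2. $\sigma_{i+1}p_{i-1}=p_{i-1}\sigma_{i+1}=s_{i-1}s_i\sigma_ip_{i+1}s_is_{i-1}$ for $i\ge2$; 3. $\sigma_{i+1}p_{i-\frac32}=p_{i-\frac32}\sigma_{i+1}$ for $i\ge3$; 4. $\sigma_{i+1}s_{i-2}=s_{i-2}\sigma_{i+1}$ for $i\ge3$; 5. $\sigma_{i+1}p_{i-2}=p_{i-2}\sigma_{i+1}$ for $i\ge3$; 6. $\sigma_{i+\frac12}p_{i-1}=p_{i-1}\sigma_{i+\frac12}$ for $i\ge2$; 7. $\sigma_{i+\frac12}p_{i-\frac32}=p_{i-\frac32}\sigma_{i+\frac12}$ for $i\ge3$; 8. $\sigma_{i+\frac12}s_{i-2}=s_{i-2}\sigma_{i+\frac12}$ for $i\ge3$; 9. $\sigma_{i+\frac12}p_{i-2}=p_{i-2}\sigma_{i+\frac12}$ for $i\ge3$. -/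

import Mathlib

open scoped Polynomial

namespace PartitionAlg

/-! ## Stacking of set partitions -/

section Stack

variable {α β γ δ : Type*}

/-- The diagram obtained by placing `d₁` above `d₂`, and identifying the bottom row of `d₁` with the
top row of `d₂`: a set partition of the vertices of the three rows `α` (top), `β` (middle) and
`γ` (bottom). -/
def stack (d₁ : Setoid (α ⊕ β)) (d₂ : Setoid (β ⊕ γ)) : Setoid (α ⊕ (β ⊕ γ)) :=
  d₁.map (Sum.map id Sum.inl) ⊔ d₂.map Sum.inr

/-- The composition `d₁ ∘ d₂`: restrict the stacked diagram to its top and bottom rows. -/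
def comp (d₁ : Setoid (α ⊕ β)) (d₂ : Setoid (β ⊕ γ)) : Setoid (α ⊕ γ) :=
  (stack d₁ d₂).comap (Sum.map id Sum.inr)

/-- The number of blocks of the stacked diagram that contain vertices of the middle row only; these
are the blocks that are removed in forming the composition. -/
noncomputable def removed (d₁ : Setoid (α ⊕ β)) (d₂ : Setoid (β ⊕ γ)) : ℕ :=
  {B ∈ (stack d₁ d₂).classes | B ⊆ Set.range fun b : β => Sum.inr (Sum.inl b)}.ncard

/-- The identity diagram, with blocks `{a, a'}`. -/
def idDiagram (α : Type*) : Setoid (α ⊕ α) := Setoid.ker (Sum.elim id id)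

/-! ### Associativity and unit laws -/

theorem map_le_iff {V W : Type*} {r : Setoid V} {f : V → W} {t : Setoid W} :
    r.map f ≤ t ↔ ∀ x y, r x y → t (f x) (f y) := by
  constructor
  · intro h x y hxy
    exact h (Relation.EqvGen.rel _ _ ⟨x, y, hxy, rfl, rfl⟩)
  · intro h
    refine Setoid.eqvGen_le ?_
    rintro _ _ ⟨x, y, hxy, rfl, rfl⟩
    exact h x y hxy

theorem map_rel {V W : Type*} {r : Setoid V} (f : V → W) {x y : V} (h : r x y) :
    r.map f (f x) (f y) := map_le_iff.1 le_rfl x y h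

theorem map_sup {V W : Type*} (r s : Setoid V) (f : V → W) :
    (r ⊔ s).map f = r.map f ⊔ s.map f := by
  apply le_antisymm
  · rw [map_le_iff]
    have : r ⊔ s ≤ (r.map f ⊔ s.map f).comap f :=
      sup_le (fun {x y} h => (le_sup_left : r.map f ≤ r.map f ⊔ s.map f) (map_rel f h))
        (fun {x y} h => (le_sup_right : s.map f ≤ r.map f ⊔ s.map f) (map_rel f h))
    exact fun x y h => this h
  · refine sup_le (map_le_iff.2 fun x y h => map_rel f ?_) (map_le_iff.2 fun x y h => map_rel f ?_)
    · exact (le_sup_left : r ≤ r ⊔ s) h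
    · exact (le_sup_right : s ≤ r ⊔ s) h

theorem map_map {U V W : Type*} (r : Setoid U) (f : U → V) (g : V → W) :
    (r.map f).map g = r.map (g ∘ f) := by
  apply le_antisymm
  · rw [map_le_iff]
    have : r.map f ≤ (r.map (g ∘ f)).comap g :=
      map_le_iff.2 fun x y h => map_rel (g ∘ f) h
    exact fun x y h => this h
  · exact map_le_iff.2 fun x y h => map_rel g (map_rel f h)

/-- The number of blocks that do not meet `P`. -/
noncomputable def blocksOff {V : Type*} (r : Setoid V) (P : Set V) : ℕ :=
  {B ∈ r.classes | Disjoint B P}.ncard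

theorem removed_eq (d₁ : Setoid (α ⊕ β)) (d₂ : Setoid (β ⊕ γ)) :
    removed d₁ d₂ = blocksOff (stack d₁ d₂) (Set.range (Sum.map id Sum.inr)) := by
  unfold removed blocksOff
  congr 1
  ext B
  simp only [Set.mem_ofPred_eq, and_congr_right_iff]
  intro _
  rw [Set.disjoint_right]
  constructor
  · rintro h _ ⟨a | c, rfl⟩ hB <;> · obtain ⟨b, hb⟩ := h hB; simp at hb
  · rintro h (a | b | c) hB
    · exact absurd hB (h ⟨Sum.inl a, rfl⟩)
    · exact ⟨b, rfl⟩
    · exact absurd hB (h ⟨Sum.inr c, rfl⟩)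

theorem blocksOff_eq {V Q : Type*} (r : Setoid V) (P : Set V) (φ : V → Q)
    (hφ : ∀ x y, r x y ↔ φ x = φ y) : blocksOff r P = (Set.range φ \ φ '' P).ncard := by
  have hinj : Set.InjOn (fun q => φ ⁻¹' {q}) (Set.range φ \ φ '' P) := by
    rintro _ ⟨⟨x, rfl⟩, -⟩ q' - h
    have : x ∈ φ ⁻¹' {φ x} := rfl
    simp only at h
    rw [h] at this
    exact this
  rw [← hinj.ncard_image, blocksOff]
  congr 1
  ext B
  constructor
  · rintro ⟨⟨y, rfl⟩, hd⟩
    refine ⟨φ y, ⟨⟨y, rfl⟩, ?_⟩, ?_⟩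
    · rintro ⟨p, hp, hpy⟩
      exact Set.disjoint_left.1 hd ((hφ p y).2 hpy) hp
    · ext x
      exact (hφ x y).symm
  · rintro ⟨_, ⟨⟨y, rfl⟩, hn⟩, rfl⟩
    refine ⟨⟨y, ?_⟩, ?_⟩
    · ext x
      exact (hφ x y).symm
    · rw [Set.disjoint_left]
      exact fun x hx hP => hn ⟨x, hP, hx⟩

/-- Gluing a partition `r` of `W` to a partition `s` of `V'` along the common part `O`, inside
`V`. -/
theorem glue_aux {O W V' V : Type*} [Finite V'] [Finite W] (o : O → W) (j : O → V')
    (i : W → V) (i' : V' → V) (hi : Function.Injective i) (hi' : Function.Injective i')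
    (hsq : ∀ u, i (o u) = i' (j u)) (hmeet : ∀ w v, i w = i' v → ∃ u, w = o u ∧ v = j u)
    (hcov : ∀ x, (∃ v, x = i' v) ∨ ∃ w, x = i w)
    (r : Setoid W) (s : Setoid V') (P : Set V') :
    (∀ x y, (r.map i ⊔ s.map i') (i' x) (i' y) ↔ ((r.comap o).map j ⊔ s) x y) ∧
    blocksOff (r.map i ⊔ s.map i') (i' '' P) =
      blocksOff ((r.comap o).map j ⊔ s) P + blocksOff r (Set.range o) := by
  classical
  set T := r.map i ⊔ s.map i' with hT
  set s' := (r.comap o).map j ⊔ s with hs'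
  have Tr : ∀ x y, r x y → T (i x) (i y) := fun x y h =>
    (le_sup_left : r.map i ≤ T) (map_rel i h)
  have Ts' : ∀ x y, s' x y → T (i' x) (i' y) := by
    have : s' ≤ T.comap i' := by
      refine sup_le (map_le_iff.2 fun x y h => ?_) (fun {x y} h => ?_)
      · change T (i' (j x)) (i' (j y))
        rw [← hsq, ← hsq]
        exact Tr _ _ h
      · exact (le_sup_right : s.map i' ≤ T) (map_rel i' h)
    exact fun x y h => this h
  have sr : ∀ u u', r (o u) (o u') → s' (j u) (j u') := fun u u' h =>
    (le_sup_left : (r.comap o).map j ≤ s') (map_rel j h)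
  obtain ⟨φ, h1, h2, h3⟩ : ∃ φ : V → Quotient s' ⊕ Quotient r,
      (∀ v, φ (i' v) = Sum.inl ⟦v⟧) ∧ (∀ w u, r w (o u) → φ (i w) = Sum.inl ⟦j u⟧) ∧
      (∀ w, (∀ u, ¬ r w (o u)) → φ (i w) = Sum.inr ⟦w⟧) := by
    have : ∀ x : V, ∃ q : Quotient s' ⊕ Quotient r,
        (∀ v, x = i' v → q = Sum.inl ⟦v⟧) ∧ (∀ w u, x = i w → r w (o u) → q = Sum.inl ⟦j u⟧) ∧
        (∀ w, x = i w → (∀ u, ¬ r w (o u)) → q = Sum.inr ⟦w⟧) := by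
      intro x
      by_cases hx : ∃ v, x = i' v
      · obtain ⟨v, rfl⟩ := hx
        refine ⟨Sum.inl ⟦v⟧, fun v' h => by rw [hi' h], ?_, ?_⟩
        · intro w u hw hr
          obtain ⟨u', rfl, rfl⟩ := hmeet w v hw.symm
          exact congrArg Sum.inl (Quotient.sound (sr _ _ hr))
        · intro w hw hr
          obtain ⟨u', rfl, rfl⟩ := hmeet w v hw.symm
          exact absurd (r.refl _) (hr u')
      · obtain ⟨w, rfl⟩ := (hcov x).resolve_left hx
        by_cases hu : ∃ u, r w (o u)
        · obtain ⟨u, hu⟩ := hu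
          refine ⟨Sum.inl ⟦j u⟧, fun v h => absurd ⟨v, h⟩ hx, ?_, ?_⟩
          · intro w' u' hw hr
            obtain rfl := hi hw
            exact congrArg Sum.inl (Quotient.sound (sr _ _ (r.trans (r.symm hu) hr)))
          · intro w' hw hr
            obtain rfl := hi hw
            exact absurd hu (hr u)
        · refine ⟨Sum.inr ⟦w⟧, fun v h => absurd ⟨v, h⟩ hx, ?_, ?_⟩
          · intro w' u' hw hr
            obtain rfl := hi hw
            exact absurd ⟨u', hr⟩ hu
          · intro w' hw hr
            rw [hi hw]
    choose φ hφ using this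
    exact ⟨φ, fun v => (hφ _).1 v rfl, fun w u => (hφ _).2.1 w u rfl,
      fun w => (hφ _).2.2 w rfl⟩
  have hφ : ∀ x y, T x y ↔ φ x = φ y := by
    have hle : T ≤ Setoid.ker φ := by
      refine sup_le (map_le_iff.2 fun x y h => ?_) (map_le_iff.2 fun x y h => ?_)
      · change φ (i x) = φ (i y)
        by_cases hu : ∃ u, r x (o u)
        · obtain ⟨u, hu⟩ := hu
          rw [h2 x u hu, h2 y u (r.trans (r.symm h) hu)]
        · push Not at hu
          rw [h3 x hu, h3 y fun u hy => hu u (r.trans h hy)]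
          exact congrArg Sum.inr (Quotient.sound h)
      · change φ (i' x) = φ (i' y)
        rw [h1, h1]
        exact congrArg Sum.inl (Quotient.sound ((le_sup_right : s ≤ s') h))
    have key : ∀ x, (∃ v, φ x = Sum.inl (Quotient.mk s' v) ∧ T x (i' v)) ∨
        (∃ w, φ x = Sum.inr (Quotient.mk r w) ∧ x = i w) := by
      intro x
      rcases hcov x with ⟨v, rfl⟩ | ⟨w, rfl⟩
      · exact Or.inl ⟨v, h1 v, T.refl _⟩
      · by_cases hu : ∃ u, r w (o u)
        · obtain ⟨u, hu⟩ := hu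
          refine Or.inl ⟨j u, h2 w u hu, ?_⟩
          rw [← hsq]
          exact Tr _ _ hu
        · push Not at hu
          exact Or.inr ⟨w, h3 w hu, rfl⟩
    intro x y
    refine ⟨fun h => hle h, fun h => ?_⟩
    rcases key x with ⟨v, hv, hxv⟩ | ⟨w, hw, rfl⟩ <;> rcases key y with ⟨v', hv', hyv⟩ | ⟨w', hw', rfl⟩
    · rw [hv, hv'] at h
      exact T.trans hxv (T.trans (Ts' _ _ (Quotient.exact (Sum.inl.inj h))) (T.symm hyv))
    · rw [hv, hw'] at h
      exact absurd h (by simp)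
    · rw [hw, hv'] at h
      exact absurd h (by simp)
    · rw [hw, hw'] at h
      exact Tr _ _ (Quotient.exact (Sum.inr.inj h))
  refine ⟨fun x y => ?_, ?_⟩
  · rw [hφ, h1, h1]
    exact ⟨fun h => Quotient.exact (Sum.inl.inj h),
      fun h => congrArg Sum.inl (Quotient.sound h)⟩
  · rw [blocksOff_eq T _ φ hφ, blocksOff_eq s' P (Quotient.mk s') fun x y => Quotient.eq.symm,
      blocksOff_eq r (Set.range o) (Quotient.mk r) fun x y => Quotient.eq.symm]
    have hset : Set.range φ \ φ '' (i' '' P) =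
        Sum.inl '' (Set.range (Quotient.mk s') \ Quotient.mk s' '' P) ∪
        Sum.inr '' (Set.range (Quotient.mk r) \ Quotient.mk r '' Set.range o) := by
      ext q
      constructor
      · rintro ⟨⟨x, rfl⟩, hn⟩
        rcases hcov x with ⟨v, rfl⟩ | ⟨w, rfl⟩
        · refine Or.inl ⟨⟦v⟧, ⟨⟨v, rfl⟩, ?_⟩, (h1 v).symm⟩
          rintro ⟨p, hp, hpv⟩
          refine hn ⟨i' p, ⟨p, hp, rfl⟩, ?_⟩
          rw [h1, h1]
          exact congrArg Sum.inl hpv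
        · by_cases hu : ∃ u, r w (o u)
          · obtain ⟨u, hu⟩ := hu
            refine Or.inl ⟨⟦j u⟧, ⟨⟨j u, rfl⟩, ?_⟩, (h2 w u hu).symm⟩
            rintro ⟨p, hp, hpv⟩
            refine hn ⟨i' p, ⟨p, hp, rfl⟩, ?_⟩
            rw [h1, h2 w u hu]
            exact congrArg Sum.inl hpv
          · push Not at hu
            refine Or.inr ⟨⟦w⟧, ⟨⟨w, rfl⟩, ?_⟩, (h3 w hu).symm⟩
            rintro ⟨_, ⟨u, rfl⟩, hw⟩
            exact hu u (r.symm (Quotient.exact hw))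
      · rintro (⟨_, ⟨⟨v, rfl⟩, hn⟩, rfl⟩ | ⟨_, ⟨⟨w, rfl⟩, hn⟩, rfl⟩)
        · refine ⟨⟨i' v, h1 v⟩, ?_⟩
          rintro ⟨_, ⟨p, hp, rfl⟩, h⟩
          rw [h1] at h
          exact hn ⟨p, hp, Sum.inl.inj h⟩
        · have hu : ∀ u, ¬ r w (o u) := fun u h =>
            hn ⟨o u, ⟨u, rfl⟩, Quotient.sound (r.symm h)⟩
          refine ⟨⟨i w, h3 w hu⟩, ?_⟩
          rintro ⟨_, ⟨p, hp, rfl⟩, h⟩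
          rw [h1] at h
          exact absurd h (by simp)
    rw [hset, Set.ncard_union_eq, Set.ncard_image_of_injective _ Sum.inl_injective,
      Set.ncard_image_of_injective _ Sum.inr_injective]
    · rw [Set.disjoint_left]
      rintro _ ⟨a, -, rfl⟩ ⟨b, -, h⟩
      exact absurd h (by simp)

theorem assoc_aux [Finite α] [Finite β] [Finite γ] [Finite δ] (d₁ : Setoid (α ⊕ β))
    (d₂ : Setoid (β ⊕ γ)) (d₃ : Setoid (γ ⊕ δ)) :
    comp (comp d₁ d₂) d₃ = comp d₁ (comp d₂ d₃) ∧
    removed d₁ d₂ + removed (comp d₁ d₂) d₃ = removed d₂ d₃ + removed d₁ (comp d₂ d₃) := by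
  let T : Setoid (α ⊕ (β ⊕ (γ ⊕ δ))) :=
    d₁.map (Sum.map id Sum.inl) ⊔ d₂.map (Sum.inr ∘ Sum.map id Sum.inl) ⊔
      d₃.map (Sum.inr ∘ Sum.inr)
  have A := glue_aux (O := α ⊕ γ) (W := α ⊕ (β ⊕ γ)) (V' := α ⊕ (γ ⊕ δ))
    (V := α ⊕ (β ⊕ (γ ⊕ δ))) (Sum.map id Sum.inr) (Sum.map id Sum.inl)
    (Sum.map id (Sum.map id Sum.inl)) (Sum.map id Sum.inr)
    (by rintro (_ | _ | _) (_ | _ | _) h <;> simp_all)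
    (by rintro (_ | _ | _) (_ | _ | _) h <;> simp_all)
    (by rintro (_ | _) <;> rfl)
    (by
      rintro (a | b | c) (a' | c' | e') h <;> simp at h
      · exact ⟨Sum.inl a, rfl, by simp [h]⟩
      · exact ⟨Sum.inr c, rfl, by simp [h]⟩)
    (by
      rintro (a | b | c | e)
      · exact Or.inl ⟨Sum.inl a, rfl⟩
      · exact Or.inr ⟨Sum.inr (Sum.inl b), rfl⟩
      · exact Or.inl ⟨Sum.inr (Sum.inl c), rfl⟩
      · exact Or.inl ⟨Sum.inr (Sum.inr e), rfl⟩)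
    (stack d₁ d₂) (d₃.map Sum.inr) (Set.range (Sum.map id Sum.inr))
  have B := glue_aux (O := β ⊕ δ) (W := β ⊕ (γ ⊕ δ)) (V' := α ⊕ (β ⊕ δ))
    (V := α ⊕ (β ⊕ (γ ⊕ δ))) (Sum.map id Sum.inr) Sum.inr
    Sum.inr (Sum.map id (Sum.map id Sum.inr))
    (by rintro (_ | _ | _) (_ | _ | _) h <;> simp_all)
    (by rintro (_ | _ | _) (_ | _ | _) h <;> simp_all)
    (by rintro (_ | _) <;> rfl)
    (by
      rintro (a | b | c) (a' | c' | e') h <;> simp at h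
      · exact ⟨Sum.inl a, rfl, by simp [h]⟩
      · exact ⟨Sum.inr c, rfl, by simp [h]⟩)
    (by
      rintro (a | b | c | e)
      · exact Or.inl ⟨Sum.inl a, rfl⟩
      · exact Or.inl ⟨Sum.inr (Sum.inl b), rfl⟩
      · exact Or.inr ⟨Sum.inr (Sum.inl c), rfl⟩
      · exact Or.inl ⟨Sum.inr (Sum.inr e), rfl⟩)
    (stack d₂ d₃) (d₁.map (Sum.map id Sum.inl)) (Set.range (Sum.map id Sum.inr))
  have hTA : (stack d₁ d₂).map (Sum.map id (Sum.map id Sum.inl)) ⊔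
      (d₃.map Sum.inr).map (Sum.map id Sum.inr) = T := by
    simp only [stack, map_sup, map_map, T]
    congr 3
    funext x
    rcases x with _ | _ <;> rfl
  have hTB : (stack d₂ d₃).map Sum.inr ⊔
      (d₁.map (Sum.map id Sum.inl)).map (Sum.map id (Sum.map id Sum.inr)) = T := by
    simp only [stack, map_sup, map_map, T]
    rw [sup_comm, ← sup_assoc]
    congr 3
    funext x
    rcases x with _ | _ <;> rfl
  rw [hTA] at A
  rw [hTB] at B
  have hA : ((stack d₁ d₂).comap (Sum.map id Sum.inr)).map (Sum.map id Sum.inl) ⊔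
      d₃.map Sum.inr = stack (comp d₁ d₂) d₃ := rfl
  have hB : ((stack d₂ d₃).comap (Sum.map id Sum.inr)).map Sum.inr ⊔
      d₁.map (Sum.map id Sum.inl) = stack d₁ (comp d₂ d₃) := sup_comm _ _
  rw [hA] at A
  rw [hB] at B
  constructor
  · ext x y
    have e1 := A.1 (Sum.map id Sum.inr x) (Sum.map id Sum.inr y)
    have e2 := B.1 (Sum.map id Sum.inr x) (Sum.map id Sum.inr y)
    have e3 : ∀ x : α ⊕ δ, Sum.map id Sum.inr (Sum.map id Sum.inr x : α ⊕ (γ ⊕ δ)) =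
        (Sum.map id (Sum.map id Sum.inr) (Sum.map id Sum.inr x : α ⊕ (β ⊕ δ)) :
          α ⊕ (β ⊕ (γ ⊕ δ))) := by
      rintro (_ | _) <;> rfl
    rw [e3, e3] at e1
    exact e1.symm.trans e2
  · have hP : (Sum.map id Sum.inr : α ⊕ (γ ⊕ δ) → α ⊕ (β ⊕ (γ ⊕ δ))) ''
          (Set.range (Sum.map id Sum.inr : α ⊕ δ → _)) =
        (Sum.map id (Sum.map id Sum.inr) : α ⊕ (β ⊕ δ) → α ⊕ (β ⊕ (γ ⊕ δ))) ''
          (Set.range (Sum.map id Sum.inr : α ⊕ δ → _)) := by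
      rw [← Set.range_comp, ← Set.range_comp]
      congr 1
      funext x
      rcases x with _ | _ <;> rfl
    have e1 := A.2
    have e2 := B.2
    rw [hP, e2] at e1
    simp only [removed_eq]
    omega

theorem one_aux (d : Setoid (α ⊕ γ)) :
    comp (idDiagram α) d = d ∧ removed (idDiagram α) d = 0 := by
  have hφ : ∀ x y, stack (idDiagram α) d x y ↔
      (Sum.elim (fun a => ⟦Sum.inl a⟧) (Quotient.mk d) x : Quotient d) =
        Sum.elim (fun a => ⟦Sum.inl a⟧) (Quotient.mk d) y := by
    have hle : stack (idDiagram α) d ≤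
        Setoid.ker (Sum.elim (fun a => ⟦Sum.inl a⟧) (Quotient.mk d)) := by
      refine sup_le (map_le_iff.2 ?_) (map_le_iff.2 fun x y h => Quotient.sound h)
      rintro (a | a) (b | b) (h : a = b) <;> subst h <;> rfl
    have hr : ∀ x, stack (idDiagram α) d x (Sum.inr (Sum.elim Sum.inl id x)) := by
      rintro (a | x)
      · exact (le_sup_left : _ ≤ stack (idDiagram α) d)
          (map_rel (r := idDiagram α) (Sum.map id Sum.inl) (x := Sum.inl a) (y := Sum.inr a) rfl)
      · exact (stack _ _).refl _
    intro x y
    refine ⟨fun h => hle h, fun h => ?_⟩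
    refine (stack _ _).trans (hr x) ((stack _ _).trans ?_ ((stack _ _).symm (hr y)))
    refine (le_sup_right : _ ≤ stack (idDiagram α) d) (map_rel (r := d) Sum.inr ?_)
    refine Quotient.exact (s := d) ?_
    rcases x with x | x <;> rcases y with y | y <;> exact h
  constructor
  · ext x y
    refine (hφ _ _).trans ?_
    rw [← Quotient.eq (r := d)]
    rcases x with x | x <;> rcases y with y | y <;> rfl
  · rw [removed_eq, blocksOff_eq _ _ _ hφ]
    rw [← Set.ncard_empty]
    congr 1
    rw [Set.sdiff_eq_empty]
    rintro _ ⟨a | a | c, rfl⟩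
    · exact ⟨_, ⟨Sum.inl a, rfl⟩, rfl⟩
    · exact ⟨_, ⟨Sum.inl a, rfl⟩, rfl⟩
    · exact ⟨_, ⟨Sum.inr c, rfl⟩, rfl⟩

theorem aux_one (d : Setoid (α ⊕ γ)) :
    comp d (idDiagram γ) = d ∧ removed d (idDiagram γ) = 0 := by
  let φ : α ⊕ (γ ⊕ γ) → Quotient d := fun x => ⟦Sum.map id (Sum.elim id id) x⟧
  have hφ : ∀ x y, stack d (idDiagram γ) x y ↔ φ x = φ y := by
    have hle : stack d (idDiagram γ) ≤ Setoid.ker φ := by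
      refine sup_le (map_le_iff.2 fun x y h => ?_) (map_le_iff.2 ?_)
      · refine Quotient.sound ?_
        rcases x with x | x <;> rcases y with y | y <;> exact h
      · rintro (a | a) (b | b) (h : a = b) <;> subst h <;> rfl
    have hr : ∀ x, stack d (idDiagram γ) x
        (Sum.map id Sum.inl (Sum.map id (Sum.elim id id) x : α ⊕ γ)) := by
      rintro (a | c | c)
      · exact (stack _ _).refl _
      · exact (stack _ _).refl _
      · exact (le_sup_right : _ ≤ stack d (idDiagram γ))
          (map_rel (r := idDiagram γ) Sum.inr (x := Sum.inr c) (y := Sum.inl c) rfl)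
    intro x y
    refine ⟨fun h => hle h, fun h => ?_⟩
    refine (stack _ _).trans (hr x) ((stack _ _).trans ?_ ((stack _ _).symm (hr y)))
    exact (le_sup_left : _ ≤ stack d (idDiagram γ)) (map_rel (r := d) _ (Quotient.exact h))
  constructor
  · ext x y
    refine (hφ _ _).trans ?_
    rw [← Quotient.eq (r := d)]
    rcases x with x | x <;> rcases y with y | y <;> rfl
  · rw [removed_eq, blocksOff_eq _ _ _ hφ]
    rw [← Set.ncard_empty]
    congr 1
    rw [Set.sdiff_eq_empty]
    rintro _ ⟨a | a | c, rfl⟩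
    · exact ⟨_, ⟨Sum.inl a, rfl⟩, rfl⟩
    · exact ⟨_, ⟨Sum.inr a, rfl⟩, rfl⟩
    · exact ⟨_, ⟨Sum.inr c, rfl⟩, rfl⟩

end Stack

/-! ## The partition algebra -/

/-- The set partitions of `{1, …, k, 1', …, k'}`: the vertices `1, …, k` of the top row are
`Sum.inl 0, …, Sum.inl (k - 1)` and the vertices `1', …, k'` of the bottom row are
`Sum.inr 0, …, Sum.inr (k - 1)`. -/
abbrev Diagram (k : ℕ) : Type := Setoid (Fin k ⊕ Fin k)

/-- The partition algebra over `ℤ[z]` (the indeterminate `z` is `Polynomial.X`): the free module on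
the set partitions of `{1, …, k, 1', …, k'}`. -/
def PartitionAlgebra (k : ℕ) : Type := Diagram k →₀ ℤ[X]

noncomputable instance (k : ℕ) : AddCommGroup (PartitionAlgebra k) :=
  inferInstanceAs (AddCommGroup (Diagram k →₀ ℤ[X]))

noncomputable instance (k : ℕ) : Module ℤ[X] (PartitionAlgebra k) :=
  inferInstanceAs (Module ℤ[X] (Diagram k →₀ ℤ[X]))

/-- The basis of the partition algebra given by the diagrams. -/
noncomputable def diagBasis (k : ℕ) : Module.Basis (Diagram k) ℤ[X] (PartitionAlgebra k) :=
  Module.Basis.ofRepr (LinearEquiv.refl ℤ[X] (Diagram k →₀ ℤ[X]))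

/-- The basis element of the partition algebra given by a diagram. -/
noncomputable def diag {k : ℕ} (d : Diagram k) : PartitionAlgebra k := diagBasis k d

/-- The bilinear product with `d₁ d₂ = z ^ ℓ (d₁ ∘ d₂)`, where `ℓ` is the number of removed
blocks. -/
noncomputable def mulBilin (k : ℕ) :
    PartitionAlgebra k →ₗ[ℤ[X]] PartitionAlgebra k →ₗ[ℤ[X]] PartitionAlgebra k :=
  (diagBasis k).constr ℤ[X] fun d₁ => (diagBasis k).constr ℤ[X] fun d₂ =>
    (Polynomial.X : ℤ[X]) ^ removed d₁ d₂ • diag (comp d₁ d₂)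

theorem mulBilin_diag {k : ℕ} (d₁ d₂ : Diagram k) :
    mulBilin k (diag d₁) (diag d₂) =
      (Polynomial.X : ℤ[X]) ^ removed d₁ d₂ • diag (comp d₁ d₂) := by
  unfold mulBilin
  rw [diag, Module.Basis.constr_basis, diag, Module.Basis.constr_basis]

theorem partitionAlgebra_induction {k : ℕ} {P : PartitionAlgebra k → Prop} (a : PartitionAlgebra k)
    (h0 : P 0) (hadd : ∀ a b, P a → P b → P (a + b)) (hsmul : ∀ (c : ℤ[X]) a, P a → P (c • a))
    (hdiag : ∀ d, P (diag d)) : P a := by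
  refine Submodule.span_induction (p := fun x _ => P x) ?_ h0 (fun x y _ _ => hadd x y)
    (fun c x _ => hsmul c x) ((diagBasis k).mem_span a)
  rintro _ ⟨d, rfl⟩
  exact hdiag d

noncomputable instance (k : ℕ) : Mul (PartitionAlgebra k) := ⟨fun a b => mulBilin k a b⟩

noncomputable instance (k : ℕ) : One (PartitionAlgebra k) := ⟨diag (idDiagram (Fin k))⟩

theorem mul_eq_mulBilin {k : ℕ} (a b : PartitionAlgebra k) : a * b = mulBilin k a b := rfl

theorem one_eq_diag {k : ℕ} : (1 : PartitionAlgebra k) = diag (idDiagram (Fin k)) := rfl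

theorem diag_mul_diag {k : ℕ} (d₁ d₂ : Diagram k) :
    diag d₁ * diag d₂ = (Polynomial.X : ℤ[X]) ^ removed d₁ d₂ • diag (comp d₁ d₂) :=
  mulBilin_diag d₁ d₂

noncomputable instance (k : ℕ) : Ring (PartitionAlgebra k) :=
  { (inferInstance : AddCommGroup (PartitionAlgebra k)),
    (inferInstance : Mul (PartitionAlgebra k)),
    (inferInstance : One (PartitionAlgebra k)) with
    left_distrib := fun a b c => map_add (mulBilin k a) b c
    right_distrib := fun a b c => LinearMap.map_add₂ (mulBilin k) a b c
    zero_mul := fun a => LinearMap.map_zero₂ (mulBilin k) a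
    mul_zero := fun a => map_zero (mulBilin k a)
    mul_assoc := by
      intro a b c
      simp only [mul_eq_mulBilin]
      induction a using partitionAlgebra_induction with
      | h0 => simp
      | hadd a a' h h' => simp [h, h']
      | hsmul r a h => simp [h]
      | hdiag d₁ =>
      induction b using partitionAlgebra_induction with
      | h0 => simp
      | hadd a a' h h' => simp [h, h']
      | hsmul r a h => simp [h]
      | hdiag d₂ =>
      induction c using partitionAlgebra_induction with
      | h0 => simp
      | hadd a a' h h' => simp only [map_add, h, h']
      | hsmul r a h => simp only [map_smul, h]
      | hdiag d₃ =>
      obtain ⟨h1, h2⟩ := assoc_aux d₁ d₂ d₃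
      simp only [map_smul, LinearMap.smul_apply, mulBilin_diag, smul_smul, h1, ← pow_add, h2]
    one_mul := by
      intro a
      rw [mul_eq_mulBilin, one_eq_diag]
      induction a using partitionAlgebra_induction with
      | h0 => simp
      | hadd a a' h h' => simp [h, h']
      | hsmul r a h => simp [h]
      | hdiag d => simp [mulBilin_diag, (one_aux d).1, (one_aux d).2]
    mul_one := by
      intro a
      rw [mul_eq_mulBilin, one_eq_diag]
      induction a using partitionAlgebra_induction with
      | h0 => simp
      | hadd a a' h h' => simp [h, h']
      | hsmul r a h => simp [h]
      | hdiag d => simp [mulBilin_diag, (aux_one d).1, (aux_one d).2] }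

noncomputable instance (k : ℕ) : Algebra ℤ[X] (PartitionAlgebra k) :=
  Algebra.ofModule (fun c a b => LinearMap.map_smul₂ (mulBilin k) c a b)
    (fun c a b => map_smul (mulBilin k a) c b)

/-! ## Generators -/

/-- The label in `{1, …, k}` of a vertex of the top or of the bottom row. -/
def label {k : ℕ} (a : Fin k) : ℕ := a + 1

/-- `s_i`, for `1 ≤ i < k`: the blocks are `{i, (i+1)'}`, `{i+1, i'}`, and `{j, j'}` for the other
`j`. -/
noncomputable def s (k i : ℕ) : PartitionAlgebra k :=
  diag (Setoid.ker (Sum.elim (fun a : Fin k => label a)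
    (fun a : Fin k => Equiv.swap i (i + 1) (label a))))

/-- `p_i`, for `1 ≤ i ≤ k`: the blocks are `{i}`, `{i'}`, and `{j, j'}` for `j ≠ i`. -/
noncomputable def p (k i : ℕ) : PartitionAlgebra k :=
  diag (Setoid.ker (Sum.elim (fun a : Fin k => (label a, false))
    (fun a : Fin k => (label a, decide (label a = i)))))

/-- `pHalf k i` is `p_{i+1/2}`, for `1 ≤ i < k`: the blocks are `{i, i+1, i', (i+1)'}`, and
`{j, j'}` for the other `j`. -/
noncomputable def pHalf (k i : ℕ) : PartitionAlgebra k :=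
  diag (Setoid.ker (Sum.elim (fun a : Fin k => if label a = i + 1 then i else label a)
    (fun a : Fin k => if label a = i + 1 then i else label a)))

/-! ## The Jucys-Murphy elements `L_i` and the elements `σ_i`, `σ_{i+1/2}` -/

/-- The recursion expressing `L_{i+1}` through `L = L_i` and `σ = σ_{i+1}`. -/
noncomputable def nextL (k i : ℕ) (L σ : PartitionAlgebra k) : PartitionAlgebra k :=
  -(s k i * L * pHalf k i) - pHalf k i * L * s k i + pHalf k i * L * p k (i + 1) * pHalf k i
    + s k i * L * s k i + σ

/-- The recursion expressing `σ_{i+1}` through `L = L_{i-1}` and `σ = σ_i`. -/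
noncomputable def nextSigma (k i : ℕ) (L σ : PartitionAlgebra k) : PartitionAlgebra k :=
  s k (i - 1) * s k i * σ * s k i * s k (i - 1)
    + s k i * pHalf k (i - 1) * L * s k i * pHalf k (i - 1) * s k i
    + pHalf k (i - 1) * L * s k i * pHalf k (i - 1)
    - s k i * pHalf k (i - 1) * L * s k (i - 1) * pHalf k i * p k i * pHalf k (i - 1)
    - pHalf k (i - 1) * p k i * pHalf k i * s k (i - 1) * L * pHalf k (i - 1) * s k i

/-- The pair `(L_i, σ_i)` (the value `σ_0 = 1` is a dummy). -/
noncomputable def jucysMurphy (k : ℕ) : ℕ → PartitionAlgebra k × PartitionAlgebra k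
  | 0 => (0, 1)
  | 1 => (p k 1, 1)
  | 2 => (nextL k 1 (p k 1) (s k 1), s k 1)
  | i + 3 =>
    let σ := nextSigma k (i + 2) (jucysMurphy k (i + 1)).1 (jucysMurphy k (i + 2)).2
    (nextL k (i + 2) (jucysMurphy k (i + 2)).1 σ, σ)

/-- `L_i`, an element of the partition algebra on `k` strands if `i ≤ k`. -/
noncomputable def L (k i : ℕ) : PartitionAlgebra k := (jucysMurphy k i).1

/-- `σ_i`, an element of the partition algebra on `k` strands if `1 ≤ i ≤ k`. -/
noncomputable def sigma (k i : ℕ) : PartitionAlgebra k := (jucysMurphy k i).2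

/-- `sigmaHalf k i` is `σ_{i+1/2}`, an element of the partition algebra on `k` strands if
`i + 1 ≤ k`. -/
noncomputable def sigmaHalf (k : ℕ) : ℕ → PartitionAlgebra k
  | 0 => 1
  | 1 => 1
  | j + 2 =>
    let i := j + 2
    s k (i - 1) * s k i * sigmaHalf k (j + 1) * s k i * s k (i - 1)
      + pHalf k (i - 1) * L k (i - 1) * s k i * pHalf k (i - 1) * s k i
      + s k i * pHalf k (i - 1) * L k (i - 1) * s k i * pHalf k (i - 1)
      - pHalf k (i - 1) * L k (i - 1) * s k (i - 1) * pHalf k i * p k i * pHalf k (i - 1)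
      - s k i * pHalf k (i - 1) * p k i * pHalf k i * s k (i - 1) * L k (i - 1)
          * pHalf k (i - 1) * s k i

/-! The defining recursions, as they are usually written. -/

theorem L_zero (k : ℕ) : L k 0 = 0 := rfl

theorem L_one (k : ℕ) : L k 1 = p k 1 := rfl

theorem sigma_one (k : ℕ) : sigma k 1 = 1 := rfl

theorem sigma_two (k : ℕ) : sigma k 2 = s k 1 := rfl

theorem L_succ (k i : ℕ) (hi : 1 ≤ i) :
    L k (i + 1) = -(s k i * L k i * pHalf k i) - pHalf k i * L k i * s k i
      + pHalf k i * L k i * p k (i + 1) * pHalf k i + s k i * L k i * s k i + sigma k (i + 1) := by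
  match i, hi with
  | 1, _ => rfl
  | i + 2, _ => rfl

theorem sigma_succ (k i : ℕ) (hi : 2 ≤ i) :
    sigma k (i + 1) = s k (i - 1) * s k i * sigma k i * s k i * s k (i - 1)
      + s k i * pHalf k (i - 1) * L k (i - 1) * s k i * pHalf k (i - 1) * s k i
      + pHalf k (i - 1) * L k (i - 1) * s k i * pHalf k (i - 1)
      - s k i * pHalf k (i - 1) * L k (i - 1) * s k (i - 1) * pHalf k i * p k i * pHalf k (i - 1)
      - pHalf k (i - 1) * p k i * pHalf k i * s k (i - 1) * L k (i - 1) * pHalf k (i - 1)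
          * s k i := by
  match i, hi with
  | i + 2, _ => rfl

end PartitionAlg

/-! The partition algebra acts on the functions of `k` variables in a finite set `N`, a tensor
power, with `z` specialised to the cardinality of `N`: the matrix entry of a diagram at `(x, y)` is
1 if the colouring by `x` above and `y` below is constant on its blocks, and 0 otherwise. These
actions for all finite `N` are jointly faithful (`eq_of_act`): enough colours separate the blocks of
any diagram, and a polynomial in `z` that vanishes at infinitely many integers is zero. So it
suffices to compare operators.

As operators the recursive elements have simple closed forms. `L_i` sums over all `m` the
substitution exchanging the values `m` and `x_i` in the variables `1, …, i`. `σ_{i+1}` exchanges the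
values `x_i` and `x_{i+1}` in the variables `1, …, i+1`, and `σ_{i+1/2}` does so in the variables
`1, …, i-1`. These are proved by induction along the recursions (`actsAsL_and_actsAsSigma`,
`actsAsSigmaHalf`).

The commutation relations are then transparent. Permuting values commutes with permuting affected
variables that do not hold the two values, respects equality of affected variables, and only
reindexes the sum over the value of such a variable. The two product formulas are direct comparisons
of substitutions. -/

namespace PartitionAlg

/-! ### Counting colourings with prescribed boundary values -/

section Counting

variable {V O N : Type*}

open Classical in
/-- Maps that are constant on the blocks of `r` and have prescribed values on the image of `o`
correspond to arbitrary maps on the blocks of `r` that do not meet this image. -/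
noncomputable def extensionsEquiv (r : Setoid V) (o : O → V) (w : O → N)
    (hw : r.comap o ≤ Setoid.ker w) :
    {h : V → N // r ≤ Setoid.ker h ∧ h ∘ o = w} ≃
      (((Quotient.mk r '' Set.range o)ᶜ : Set (Quotient r)) → N) where
  toFun h q := Quotient.lift h.1 (fun _ _ hab => h.2.1 hab) q.1
  invFun g := by
    refine ⟨fun v => if hv : ∃ u, r (o u) v then w hv.choose
      else g ⟨Quotient.mk r v, fun ⟨_, ⟨u, hu⟩, h⟩ => hv ⟨u, hu ▸ Quotient.exact h⟩⟩, ?_, ?_⟩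
    · intro a b hab
      have hiff : (∃ u, r (o u) a) ↔ ∃ u, r (o u) b :=
        exists_congr fun u => ⟨fun h => r.trans h hab, fun h => r.trans h (r.symm hab)⟩
      change dite _ _ _ = dite _ _ _
      by_cases ha : ∃ u, r (o u) a
      · have hb := hiff.1 ha
        rw [dif_pos ha, dif_pos hb]
        exact hw (r.trans ha.choose_spec (r.trans hab (r.symm hb.choose_spec)))
      · rw [dif_neg ha, dif_neg (mt hiff.2 ha)]
        congr 2
        exact Quotient.sound hab
    · funext u
      have hu : ∃ u', r (o u') (o u) := ⟨u, r.refl _⟩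
      change dite _ _ _ = _
      rw [dif_pos hu]
      exact hw hu.choose_spec
  left_inv := by
    rintro ⟨h, hr, rfl⟩
    apply Subtype.ext
    funext v
    change dite _ _ _ = _
    split_ifs with hv
    · exact hr hv.choose_spec
    · rfl
  right_inv := by
    intro g
    funext ⟨q, hq⟩
    induction q using Quotient.inductionOn with
    | h v =>
      change dite _ _ _ = _
      rw [dif_neg]
      rintro ⟨u, hu⟩
      exact hq ⟨_, ⟨u, rfl⟩, Quotient.sound hu⟩

/-- Blocks meeting the image of `o` have a forced colour, consistent by `hw`; every other block is
coloured freely. -/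
theorem card_extensions [Finite V] (r : Setoid V) (o : O → V) (w : O → N)
    (hw : r.comap o ≤ Setoid.ker w) :
    Nat.card {h : V → N // r ≤ Setoid.ker h ∧ h ∘ o = w} =
      Nat.card N ^ blocksOff r (Set.range o) := by
  rw [Nat.card_congr (extensionsEquiv r o w hw), Nat.card_fun,
    blocksOff_eq r _ (Quotient.mk r) fun _ _ => Quotient.eq.symm, Nat.card_coe_set_eq]
  congr 2
  rw [Set.range_eq_univ.2 Quotient.mk_surjective, Set.compl_eq_univ_sdiff]

end Counting

/-! ### Colourings of stacked diagrams -/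

section Coloring

variable {α β γ N : Type*}

theorem stack_le_ker (d₁ : Setoid (α ⊕ β)) (d₂ : Setoid (β ⊕ γ)) (x : α → N) (y : β → N)
    (z : γ → N) : stack d₁ d₂ ≤ Setoid.ker (Sum.elim x (Sum.elim y z)) ↔
      d₁ ≤ Setoid.ker (Sum.elim x y) ∧ d₂ ≤ Setoid.ker (Sum.elim y z) := by
  rw [stack, sup_le_iff, map_le_iff, map_le_iff]
  refine and_congr ⟨fun h a b hab => ?_, fun h a b hab => ?_⟩ Iff.rfl
  · have := h a b hab
    rcases a with a | a <;> rcases b with b | b <;> exact this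
  · have := h hab
    rcases a with a | a <;> rcases b with b | b <;> exact this

/-- This count is the source of the factor `z ^ ℓ`: once the outer rows are coloured compatibly,
only the removed blocks retain a free colour. -/
theorem card_middle_colorings [Finite α] [Finite β] [Finite γ] (d₁ : Setoid (α ⊕ β))
    (d₂ : Setoid (β ⊕ γ)) (x : α → N) (z : γ → N)
    (h : comp d₁ d₂ ≤ Setoid.ker (Sum.elim x z)) :
    Nat.card {y : β → N // d₁ ≤ Setoid.ker (Sum.elim x y) ∧ d₂ ≤ Setoid.ker (Sum.elim y z)} =
      Nat.card N ^ removed d₁ d₂ := by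
  -- The removed blocks are those off the outer rows, and `h` is precisely the consistency needed to
  -- extend from these rows.
  rw [removed_eq, ← card_extensions _ _ _ h]
  refine Nat.card_congr
    { toFun := fun y => ⟨Sum.elim x (Sum.elim y.1 z), (stack_le_ker d₁ d₂ x y.1 z).2 y.2, ?_⟩
      invFun := fun h => ⟨fun b => h.1 (Sum.inr (Sum.inl b)), ?_⟩
      left_inv := fun y => rfl
      right_inv := fun h => ?_ }
  · funext u
    rcases u with u | u <;> rfl
  · have := h.2.1
    rw [← stack_le_ker]
    convert this using 2
    funext v
    rcases v with a | b | c
    · exact (congrFun h.2.2 (Sum.inl a)).symm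
    · rfl
    · exact (congrFun h.2.2 (Sum.inr c)).symm
  · apply Subtype.ext
    funext v
    rcases v with a | b | c
    · exact (congrFun h.2.2 (Sum.inl a)).symm
    · rfl
    · exact (congrFun h.2.2 (Sum.inr c)).symm

/-- Complements `card_middle_colorings`: if the outer colouring is incompatible with the
composition, there is no middle colouring at all. -/
theorem comp_le_ker (d₁ : Setoid (α ⊕ β)) (d₂ : Setoid (β ⊕ γ)) (x : α → N) (y : β → N)
    (z : γ → N) (h₁ : d₁ ≤ Setoid.ker (Sum.elim x y)) (h₂ : d₂ ≤ Setoid.ker (Sum.elim y z)) :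
    comp d₁ d₂ ≤ Setoid.ker (Sum.elim x z) := by
  intro a b hab
  have := (stack_le_ker d₁ d₂ x y z).2 ⟨h₁, h₂⟩ hab
  rcases a with a | a <;> rcases b with b | b <;> exact this

end Coloring

/-! ### The tensor space action and its joint faithfulness -/

section Action

variable {k : ℕ}

open Classical in
/-- The sum of the coefficients of the diagrams that refine `e`. -/
noncomputable def coeffBelow (e : Diagram k) : PartitionAlgebra k →ₗ[ℤ[X]] ℤ[X] :=
  (diagBasis k).constr ℤ[X] fun d => if d ≤ e then 1 else 0

open Classical in
theorem coeffBelow_diag (e d : Diagram k) : coeffBelow e (diag d) = if d ≤ e then 1 else 0 := by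
  rw [coeffBelow, diag, Module.Basis.constr_basis]

/-- Möbius inversion on the finite refinement order: if the coefficients of all strictly finer
diagrams vanish, the sum below `e` reduces to the coefficient of `e`. -/
theorem eq_zero_of_coeffBelow {a : PartitionAlgebra k} (h : ∀ e, coeffBelow e a = 0) : a = 0 := by
  classical
  have hfin : Finite (Diagram k) :=
    Finite.of_injective (fun r : Diagram k => r.r) fun r t h => Setoid.ext fun x y =>
      iff_of_eq (congrFun (congrFun h x) y)
  have := Fintype.ofFinite (Diagram k)
  have key : ∀ e, (diagBasis k).repr a e = 0 := by
    intro e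
    induction e using WellFoundedLT.induction with
    | ind e ih =>
      have he := h e
      rw [coeffBelow, Module.Basis.constr_apply_fintype] at he
      rw [Finset.sum_eq_single e] at he
      · simpa using he
      · intro d _ hd
        by_cases hde : d ≤ e
        · have := ih d (lt_of_le_of_ne hde hd)
          simp [Module.Basis.equivFun_apply, this]
        · simp [hde]
      · simp
  exact (diagBasis k).ext_elem fun e => by simp [key e]

variable {N : Type*} [Fintype N]

/-- The action of the partition algebra, with `z` specialised to the number of elements of `N`, on
the functions of `k` variables in `N`; these form the `k`-th tensor power of `N → ℤ`. -/
noncomputable def act (a : PartitionAlgebra k) (f : (Fin k → N) → ℤ) (x : Fin k → N) : ℤ :=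
  ∑ y, (coeffBelow (Setoid.ker (Sum.elim x y)) a).eval (Fintype.card N : ℤ) * f y

theorem act_zero (f : (Fin k → N) → ℤ) (x : Fin k → N) : act 0 f x = 0 := by
  simp [act]

theorem act_add (a b : PartitionAlgebra k) (f : (Fin k → N) → ℤ) (x : Fin k → N) :
    act (a + b) f x = act a f x + act b f x := by
  simp [act, add_mul, Finset.sum_add_distrib]

theorem act_neg (a : PartitionAlgebra k) (f : (Fin k → N) → ℤ) (x : Fin k → N) :
    act (-a) f x = -act a f x := by
  simp [act]

theorem act_sub (a b : PartitionAlgebra k) (f : (Fin k → N) → ℤ) (x : Fin k → N) :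
    act (a - b) f x = act a f x - act b f x := by
  simp [act, sub_mul]

theorem act_smul (c : ℤ[X]) (a : PartitionAlgebra k) (f : (Fin k → N) → ℤ) (x : Fin k → N) :
    act (c • a) f x = c.eval (Fintype.card N : ℤ) * act a f x := by
  simp [act, Finset.mul_sum, mul_assoc]

theorem act_apply_zero (a : PartitionAlgebra k) : act a (0 : (Fin k → N) → ℤ) = 0 := by
  funext x
  simp [act]

theorem act_apply_add (a : PartitionAlgebra k) (f g : (Fin k → N) → ℤ) :
    act a (f + g) = act a f + act a g := by
  funext x
  simp [act, mul_add, Finset.sum_add_distrib]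

theorem act_apply_smul (a : PartitionAlgebra k) (c : ℤ) (f : (Fin k → N) → ℤ) :
    act a (c • f) = c • act a f := by
  funext x
  simp [act, Finset.mul_sum, mul_left_comm]

open Classical in
theorem act_diag (d : Diagram k) (f : (Fin k → N) → ℤ) (x : Fin k → N) :
    act (diag d) f x = ∑ y, if d ≤ Setoid.ker (Sum.elim x y) then f y else 0 := by
  refine Finset.sum_congr rfl fun y _ => ?_
  rw [coeffBelow_diag]
  split_ifs <;> simp

/-- By bilinearity two diagrams suffice. An entry of the product of their matrices counts the
compatible colourings of the middle row, which is `|N| ^ ℓ` or 0 according to the composed diagram.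
-/
theorem act_mul (a b : PartitionAlgebra k) (f : (Fin k → N) → ℤ) :
    act (a * b) f = act a (act b f) := by
  classical
  induction a using partitionAlgebra_induction with
  | h0 => funext x; simp [act_zero]
  | hadd a a' h h' => funext x; rw [add_mul, act_add, act_add, h, h']
  | hsmul r a h => funext x; rw [smul_mul_assoc, act_smul, act_smul, h]
  | hdiag d₁ =>
  induction b using partitionAlgebra_induction with
  | h0 =>
    have : act (0 : PartitionAlgebra k) f = 0 := funext fun x => act_zero f x
    rw [mul_zero, this, act_apply_zero]
  | hadd b b' h h' =>
    have : act (b + b') f = act b f + act b' f := funext fun x => act_add b b' f x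
    rw [this, act_apply_add, ← h, ← h', mul_add]
    exact funext fun x => act_add _ _ f x
  | hsmul r b h =>
    have : act (r • b) f = r.eval (Fintype.card N : ℤ) • act b f :=
      funext fun x => act_smul r b f x
    rw [this, act_apply_smul, ← h, mul_smul_comm]
    exact funext fun x => act_smul _ _ f x
  | hdiag d₂ =>
  funext x
  rw [diag_mul_diag, act_smul, act_diag, act_diag, Polynomial.eval_pow, Polynomial.eval_X,
    Finset.mul_sum]
  simp only [act_diag, ← Finset.sum_filter]
  have hfactor : ∀ y : Fin k → N, (if d₁ ≤ Setoid.ker (Sum.elim x y) then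
      ∑ z with d₂ ≤ Setoid.ker (Sum.elim y z), f z else 0) =
      ∑ z, if d₁ ≤ Setoid.ker (Sum.elim x y) ∧ d₂ ≤ Setoid.ker (Sum.elim y z) then f z else 0 := by
    intro y
    split_ifs with hy <;> simp [hy, Finset.sum_filter]
  rw [Finset.sum_filter, Finset.sum_congr rfl fun y _ => hfactor y, Finset.sum_comm,
    ← Finset.mul_sum, Finset.mul_sum]
  refine Finset.sum_congr rfl fun z _ => ?_
  rw [← Finset.sum_filter, Finset.sum_const, nsmul_eq_mul]
  by_cases hz : comp d₁ d₂ ≤ Setoid.ker (Sum.elim x z)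
  · have := card_middle_colorings d₁ d₂ x z hz
    rw [Nat.card_eq_fintype_card, Nat.card_eq_fintype_card, Fintype.card_subtype] at this
    rw [this, if_pos hz, Nat.cast_pow]
  · rw [if_neg hz, Finset.filter_false_of_mem]
    · simp
    · exact fun y _ hy => hz (comp_le_ker d₁ d₂ x y z hy.1 hy.2)

/-- Colouring each vertex by its block of `e` gives rows whose kernel is exactly `e`, so a single
matrix entry reads off `coeffBelow e` evaluated at `n`. This works for every `n` at least the number
of blocks, hence at infinitely many points. -/
theorem eq_of_act {a b : PartitionAlgebra k}
    (h : ∀ (n : ℕ) (f : (Fin k → Fin n) → ℤ) (x : Fin k → Fin n), act a f x = act b f x) :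
    a = b := by
  rw [← sub_eq_zero]
  refine eq_zero_of_coeffBelow fun e => Polynomial.eq_zero_of_infinite_isRoot _ ?_
  have hfin : Finite (Quotient e) := inferInstance
  obtain ⟨m, ⟨φ⟩⟩ := Finite.exists_equiv_fin (Quotient e)
  refine Set.Infinite.mono (s := Set.range fun j : ℕ => ((m + j : ℕ) : ℤ)) ?_
    (Set.infinite_range_of_injective fun i j hij => by simpa using hij)
  rintro _ ⟨j, rfl⟩
  set g : Fin k ⊕ Fin k → Fin (m + j) := fun v => Fin.castAdd j (φ (Quotient.mk e v)) with hg
  have he : Setoid.ker (Sum.elim (g ∘ Sum.inl) (g ∘ Sum.inr)) = e := by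
    rw [Sum.elim_comp_inl_inr]
    ext u v
    rw [Setoid.ker_def]
    simp only [hg, (Fin.castAdd_injective m j).eq_iff, φ.injective.eq_iff]
    exact Quotient.eq
  -- The indicator of the bottom colouring, evaluated at the top colouring, extracts that matrix
  -- entry.
  have := h (m + j) (Pi.single (g ∘ Sum.inr) 1) (g ∘ Sum.inl)
  rw [← sub_eq_zero, ← act_sub, act, Finset.sum_eq_single (g ∘ Sum.inr), he] at this
  · simpa using this
  · intro y _ hy
    simp [hy]
  · simp

end Action

/-! ### Operators of the generators -/

section Generators

variable {k : ℕ} {N : Type*} [Fintype N]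

theorem act_diag_eq_single {d : Diagram k} {x y : Fin k → N}
    (h : ∀ y', d ≤ Setoid.ker (Sum.elim x y') ↔ y' = y) (f : (Fin k → N) → ℤ) :
    act (diag d) f x = f y := by
  classical
  simp [act_diag, h]

theorem act_s {i : ℕ} {c d : Fin k} (hc : c.val + 1 = i) (hd : d.val = i)
    (f : (Fin k → N) → ℤ) (x : Fin k → N) :
    act (s k i) f x = f (x ∘ Equiv.swap c d) := by
  have hlabel : ∀ a : Fin k, Equiv.swap i (i + 1) (label a) = label (Equiv.swap c d a) := by
    intro a
    have hinj : Function.Injective (label (k := k)) := fun u v huv =>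
      Fin.ext (by simpa [label] using huv)
    have := hinj.swap_apply c d a
    rwa [show label c = i from hc, show label d = i + 1 by rw [label, hd]] at this
  have hinj : ∀ a b : Fin k, label a = label b → a = b := fun a b h =>
    Fin.ext (by simpa [label] using h)
  refine act_diag_eq_single (fun y => ⟨fun h => ?_, ?_⟩) f
  · funext a
    have : Setoid.ker (Sum.elim (fun a : Fin k => label a)
      (fun a : Fin k => Equiv.swap i (i + 1) (label a))) (Sum.inr a)
        (Sum.inl (Equiv.swap c d a)) := hlabel a
    exact h this
  · rintro rfl u v huv
    rw [Setoid.ker_def] at huv ⊢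
    rcases u with u | u <;> rcases v with v | v <;>
      simp only [Sum.elim_inl, Sum.elim_inr, hlabel, Function.comp_apply] at huv ⊢ <;>
      rw [hinj _ _ huv]

theorem act_p {i : ℕ} {c : Fin k} (hc : c.val + 1 = i)
    (f : (Fin k → N) → ℤ) (x : Fin k → N) :
    act (p k i) f x = ∑ m, f (Function.update x c m) := by
  classical
  have hiff : ∀ y : Fin k → N, Setoid.ker (Sum.elim (fun a : Fin k => (label a, false))
      (fun a : Fin k => (label a, decide (label a = i)))) ≤ Setoid.ker (Sum.elim x y) ↔
      ∀ a, a ≠ c → y a = x a := by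
    intro y
    constructor
    · intro h a ha
      have hai : label a ≠ i := fun hl => ha (Fin.ext (by rw [label] at hl; omega))
      have : Setoid.ker (Sum.elim (fun a : Fin k => (label a, false))
        (fun a : Fin k => (label a, decide (label a = i)))) (Sum.inr a) (Sum.inl a) := by
          simp [Setoid.ker_def, hai]
      exact h this
    · intro h u v huv
      rw [Setoid.ker_def] at huv ⊢
      rcases u with u | u <;> rcases v with v | v <;>
        simp only [Sum.elim_inl, Sum.elim_inr, Prod.mk.injEq, label, Nat.add_right_cancel_iff,
          Fin.val_inj] at huv ⊢ <;> obtain ⟨rfl, huv⟩ := huv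
      · rfl
      · refine (h u ?_).symm
        rintro rfl
        simp [hc] at huv
      · refine h u ?_
        rintro rfl
        simp [hc] at huv
      · rfl
  rw [p, act_diag]
  simp only [hiff]
  rw [← Finset.sum_filter]
  symm
  refine Finset.sum_bij' (fun m _ => Function.update x c m) (fun y _ => y c) ?_ ?_ ?_ ?_ ?_
  · intro m _
    simp +contextual
  · simp
  · simp
  · intro y hy
    funext a
    by_cases ha : a = c
    · subst ha
      simp
    · simp only [Finset.mem_filter] at hy
      rw [Function.update_of_ne ha, hy.2 a ha]
  · simp

/-- The vertical connections force `y = x` and the block of size four forces `x c = x d`, so the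
matrix is diagonal. -/
theorem act_pHalf [DecidableEq N] {i : ℕ} {c d : Fin k} (hc : c.val + 1 = i) (hd : d.val = i)
    (f : (Fin k → N) → ℤ) (x : Fin k → N) :
    act (pHalf k i) f x = if x c = x d then f x else 0 := by
  classical
  have hiff : ∀ y : Fin k → N,
      Setoid.ker (Sum.elim (fun a : Fin k => if label a = i + 1 then i else label a)
        (fun a : Fin k => if label a = i + 1 then i else label a)) ≤ Setoid.ker (Sum.elim x y) ↔
      x c = x d ∧ y = x := by
    intro y
    constructor
    · intro h
      constructor
      · have : Setoid.ker (Sum.elim (fun a : Fin k => if label a = i + 1 then i else label a)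
          (fun a : Fin k => if label a = i + 1 then i else label a)) (Sum.inl c) (Sum.inl d) := by
            simp [Setoid.ker_def, label, hc, hd]
        exact h this
      · funext a
        have : Setoid.ker (Sum.elim (fun a : Fin k => if label a = i + 1 then i else label a)
          (fun a : Fin k => if label a = i + 1 then i else label a)) (Sum.inr a) (Sum.inl a) := rfl
        exact h this
    · rintro ⟨hx, rfl⟩ u v huv
      have key : ∀ a b : Fin k, (if label a = i + 1 then i else label a) =
          (if label b = i + 1 then i else label b) → y a = y b := by
        intro a b hab
        have hd' : ∀ a : Fin k, label a = i + 1 → a = d := fun a ha =>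
          Fin.ext (by rw [label] at ha; omega)
        have hc' : ∀ a : Fin k, label a = i → a = c := fun a ha =>
          Fin.ext (by rw [label] at ha; omega)
        split_ifs at hab with h1 h2 h2
        · rw [hd' a h1, hd' b h2]
        · rw [hd' a h1, hc' b hab.symm, hx]
        · rw [hd' b h2, hc' a hab, hx]
        · rw [show a = b from Fin.ext (by simpa [label] using hab)]
      rcases u with u | u <;> rcases v with v | v <;> exact key u v huv
  rw [pHalf, act_diag]
  simp only [hiff]
  by_cases hx : x c = x d <;> simp [hx]

end Generators

/-! ### Closed forms of the Jucys-Murphy and σ operators -/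

section ClosedForms

variable {k : ℕ} {N : Type*} [Fintype N]

theorem act_one (f : (Fin k → N) → ℤ) (x : Fin k → N) : act 1 f x = f x := by
  rw [one_eq_diag]
  refine act_diag_eq_single (fun y => ⟨fun h => ?_, ?_⟩) f
  · funext e
    have : idDiagram (Fin k) (Sum.inr e) (Sum.inl e) := rfl
    exact h this
  · rintro rfl u v huv
    rw [idDiagram, Setoid.ker_def] at huv
    rw [Setoid.ker_def]
    rcases u with u | u <;> rcases v with v | v <;> simp only [Sum.elim_inl, Sum.elim_inr, id]
      at huv ⊢ <;> rw [huv]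

variable [DecidableEq N]

/-- `a` acts by summation over all values `m` after exchanging `m` and the value of the variable `i`
throughout the variables `1, …, i`. -/
def ActsAsL (N : Type*) [Fintype N] [DecidableEq N] (i : ℕ) (a : PartitionAlgebra k) : Prop :=
  ∀ c : Fin k, c.val + 1 = i → ∀ (f : (Fin k → N) → ℤ) (x : Fin k → N),
    act a f x = ∑ m, f fun e => if e ≤ c then Equiv.swap m (x c) (x e) else x e

/-- `a` exchanges the values of the variables `i` and `i + 1` throughout the variables
`1, …, i + 1`. -/
def ActsAsSigma (N : Type*) [Fintype N] [DecidableEq N] (i : ℕ) (a : PartitionAlgebra k) : Prop :=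
  ∀ c d : Fin k, c.val + 1 = i → d.val = i → ∀ (f : (Fin k → N) → ℤ) (x : Fin k → N),
    act a f x = f fun e => if e ≤ d then Equiv.swap (x c) (x d) (x e) else x e

/-- `a` exchanges the values of the variables `i` and `i + 1` throughout the variables
`1, …, i - 1`. -/
def ActsAsSigmaHalf (N : Type*) [Fintype N] [DecidableEq N] (i : ℕ) (a : PartitionAlgebra k) :
    Prop :=
  ∀ c d : Fin k, c.val + 1 = i → d.val = i → ∀ (f : (Fin k → N) → ℤ) (x : Fin k → N),
    act a f x = f fun e => if e < c then Equiv.swap (x c) (x d) (x e) else x e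

/-- Case split for pointwise checks of substitutions: away from three consecutive variables, all
transpositions are trivial and all the range conditions coincide. -/
theorem eq_or_apart {b c d : Fin k} (hc : c.val = b.val + 1) (hd : d.val = b.val + 2)
    (e : Fin k) : e = b ∨ e = c ∨ e = d ∨ (Equiv.swap b c e = e ∧ Equiv.swap c d e = e ∧
      e ≠ b ∧ e ≠ c ∧ e ≠ d ∧ (e ≤ c ↔ e ≤ b) ∧ (e ≤ d ↔ e ≤ b) ∧ (e < c ↔ e ≤ b) ∧
      (e < b ↔ e ≤ b)) := by
  by_cases h1 : e = b
  · exact Or.inl h1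
  by_cases h2 : e = c
  · exact Or.inr (Or.inl h2)
  by_cases h3 : e = d
  · exact Or.inr (Or.inr (Or.inl h3))
  refine Or.inr (Or.inr (Or.inr ⟨Equiv.swap_apply_of_ne_of_ne h1 h2,
    Equiv.swap_apply_of_ne_of_ne h2 h3, h1, h2, h3, ?_⟩))
  simp only [Fin.ext_iff, Fin.le_def, Fin.lt_def] at *
  omega

/-- With `b`, `c`, `d` the variables `i-1`, `i`, `i+1`, the leading term of the recursion exchanges
`x c` and `x d` everywhere required except at `b`, where it keeps `x b`. This is wrong only if `x b`
is one of the two values. The second and fourth terms, present when `x b = x d`, add the right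
substitution and remove the wrong one; the third and fifth do so when `x b = x c`. -/
theorem actsAsSigma_succ {j : ℕ} (hL : ActsAsL N (j + 1) (L k (j + 1)))
    (hs : ActsAsSigma N (j + 1) (sigma k (j + 2))) :
    ActsAsSigma N (j + 2) (sigma k (j + 3)) := by
  intro c d hc hd f x
  obtain ⟨b, hb⟩ : ∃ b : Fin k, b.val = j := ⟨⟨j, by omega⟩, rfl⟩
  have s1 := act_s (N := N) (i := j + 1) (c := b) (d := c) (by omega) (by omega)
  have s2 := act_s (N := N) (i := j + 2) (c := c) (d := d) (by omega) (by omega)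
  have h1 := act_pHalf (N := N) (i := j + 1) (c := b) (d := c) (by omega) (by omega)
  have h2 := act_pHalf (N := N) (i := j + 2) (c := c) (d := d) (by omega) (by omega)
  have p2 := act_p (N := N) (i := j + 2) (c := c) (by omega)
  have l1 := hL b (by omega)
  have sg := hs b c (by omega) (by omega)
  have hpos := eq_or_apart (b := b) (c := c) (d := d) (by omega) (by omega)
  have hbc : b < c := by rw [Fin.lt_def]; omega
  have hcd : c < d := by rw [Fin.lt_def]; omega
  have hbd := hbc.trans hcd
  have e1 : Equiv.swap c d b = b := Equiv.swap_apply_of_ne_of_ne hbc.ne hbd.ne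
  have e2 : Equiv.swap b c d = d := Equiv.swap_apply_of_ne_of_ne hbd.ne' hcd.ne'
  rw [sigma_succ k (j + 2) (by omega)]
  simp only [Nat.add_succ_sub_one, act_add, act_sub, act_mul, s1, s2, h1, h2, p2, l1, sg]
  clear s1 s2 h1 h2 p2 l1 sg hL hs
  -- Each sum over a value coming from `L` or `p` is pinned to one term by the equality imposed by a
  -- later `pHalf`.
  simp only [Function.comp_apply, e1, e2, Equiv.swap_apply_left, Equiv.swap_apply_right, le_refl,
    hbc.not_ge, hbd.not_ge, hcd.ne', hbc.ne, if_true, if_false, Finset.sum_ite_eq',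
    Finset.sum_ite_eq, Finset.mem_univ, Function.update_self, Function.update_of_ne, ne_eq,
    not_false_eq_true]
  by_cases hd' : x b = x d <;> by_cases hc' : x b = x c
  -- If all three values agree, every term is the same substitution, and `1 + 1 + 1 - 1 - 1 = 1`.
  · have key : ∀ {g₁ g₂ g₃ g₄ g₅ φ : Fin k → N}, g₁ = φ → g₂ = φ → g₃ = φ → g₄ = φ → g₅ = φ →
        f g₁ + f g₂ + f g₃ - f g₄ - f g₅ = f φ := by
      rintro _ _ _ _ _ _ rfl rfl rfl rfl rfl
      ring
    simp only [if_pos hd', if_pos hc']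
    refine key ?_ ?_ ?_ ?_ ?_ <;> funext e <;>
      obtain rfl | rfl | rfl | ⟨h1, h2, h3, h4, h5, h6, h7, -⟩ := hpos e <;> clear hpos <;>
      simp_all [le_of_lt, ne_of_gt, Function.update_apply]
  · have key : ∀ {g₁ g₂ g₄ φ : Fin k → N}, g₁ = g₄ → g₂ = φ →
        f g₁ + f g₂ + 0 - f g₄ - 0 = f φ := by
      rintro _ _ _ _ rfl rfl
      ring
    simp only [if_pos hd', if_neg hc']
    refine key ?_ ?_ <;> funext e <;>
      obtain rfl | rfl | rfl | ⟨h1, h2, h3, h4, h5, h6, h7, -⟩ := hpos e <;> clear hpos <;>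
      simp_all [le_of_lt, ne_of_gt, Function.update_apply] <;> grind
  · have key : ∀ {g₁ g₃ g₅ φ : Fin k → N}, g₁ = g₅ → g₃ = φ →
        f g₁ + 0 + f g₃ - 0 - f g₅ = f φ := by
      rintro _ _ _ _ rfl rfl
      ring
    simp only [if_neg hd', if_pos hc']
    refine key ?_ ?_ <;> funext e <;>
      obtain rfl | rfl | rfl | ⟨h1, h2, h3, h4, h5, h6, h7, -⟩ := hpos e <;> clear hpos <;>
      simp_all [le_of_lt, ne_of_gt, Function.update_apply] <;> grind
  · have key : ∀ {g₁ φ : Fin k → N}, g₁ = φ → f g₁ + 0 + 0 - 0 - 0 = f φ := by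
      rintro _ _ rfl
      ring
    simp only [if_neg hd', if_neg hc']
    refine key ?_ <;> funext e <;>
      obtain rfl | rfl | rfl | ⟨h1, h2, h3, h4, h5, h6, h7, -⟩ := hpos e <;> clear hpos <;>
      simp_all [le_of_lt] <;> grind

/-- The leading term again errs only at `b`. The roles of the corrections are interchanged: the
second and fourth terms now require `x b = x c`, the third and fifth `x b = x d`. -/
theorem actsAsSigmaHalf_succ {j : ℕ} (hL : ActsAsL N (j + 1) (L k (j + 1)))
    (hs : ActsAsSigmaHalf N (j + 1) (sigmaHalf k (j + 1))) :
    ActsAsSigmaHalf N (j + 2) (sigmaHalf k (j + 2)) := by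
  intro c d hc hd f x
  obtain ⟨b, hb⟩ : ∃ b : Fin k, b.val = j := ⟨⟨j, by omega⟩, rfl⟩
  have s1 := act_s (N := N) (i := j + 1) (c := b) (d := c) (by omega) (by omega)
  have s2 := act_s (N := N) (i := j + 2) (c := c) (d := d) (by omega) (by omega)
  have h1 := act_pHalf (N := N) (i := j + 1) (c := b) (d := c) (by omega) (by omega)
  have h2 := act_pHalf (N := N) (i := j + 2) (c := c) (d := d) (by omega) (by omega)
  have p2 := act_p (N := N) (i := j + 2) (c := c) (by omega)
  have l1 := hL b (by omega)
  have sg := hs b c (by omega) (by omega)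
  have hpos := eq_or_apart (b := b) (c := c) (d := d) (by omega) (by omega)
  have hbc : b < c := by rw [Fin.lt_def]; omega
  have hcd : c < d := by rw [Fin.lt_def]; omega
  have hbd := hbc.trans hcd
  have e1 : Equiv.swap c d b = b := Equiv.swap_apply_of_ne_of_ne hbc.ne hbd.ne
  have e2 : Equiv.swap b c d = d := Equiv.swap_apply_of_ne_of_ne hbd.ne' hcd.ne'
  rw [sigmaHalf]
  simp only [Nat.add_succ_sub_one, act_add, act_sub, act_mul, s1, s2, h1, h2, p2, l1, sg]
  clear s1 s2 h1 h2 p2 l1 sg hL hs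
  simp only [Function.comp_apply, e1, e2, Equiv.swap_apply_left, Equiv.swap_apply_right, le_refl,
    hbc.not_ge, hbd.not_ge, hcd.ne', hbc.ne, if_true, if_false, Finset.sum_ite_eq',
    Finset.sum_ite_eq, Finset.mem_univ, Function.update_self, Function.update_of_ne, ne_eq,
    not_false_eq_true]
  by_cases hd' : x b = x d <;> by_cases hc' : x b = x c
  · have key : ∀ {g₁ g₂ g₃ g₄ g₅ φ : Fin k → N}, g₁ = φ → g₂ = φ → g₃ = φ → g₄ = φ → g₅ = φ →
        f g₁ + f g₂ + f g₃ - f g₄ - f g₅ = f φ := by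
      rintro _ _ _ _ _ _ rfl rfl rfl rfl rfl
      ring
    simp only [if_pos hd', if_pos hc']
    refine key ?_ ?_ ?_ ?_ ?_ <;> funext e <;>
      obtain rfl | rfl | rfl | ⟨h1, h2, h3, h4, h5, h6, h7, -⟩ := hpos e <;> clear hpos <;>
      simp_all [ne_of_gt, Function.update_apply]
  · have key : ∀ {g₁ g₃ g₅ φ : Fin k → N}, g₁ = g₅ → g₃ = φ →
        f g₁ + 0 + f g₃ - 0 - f g₅ = f φ := by
      rintro _ _ _ _ rfl rfl
      ring
    simp only [if_pos hd', if_neg hc']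
    refine key ?_ ?_ <;> funext e <;>
      obtain rfl | rfl | rfl | ⟨h1, h2, h3, h4, h5, h6, h7, -⟩ := hpos e <;> clear hpos <;>
      simp_all [le_of_lt, ne_of_gt, Function.update_apply] <;> grind
  · have key : ∀ {g₁ g₂ g₄ φ : Fin k → N}, g₁ = g₄ → g₂ = φ →
        f g₁ + f g₂ + 0 - f g₄ - 0 = f φ := by
      rintro _ _ _ _ rfl rfl
      ring
    simp only [if_neg hd', if_pos hc']
    refine key ?_ ?_ <;> funext e <;>
      obtain rfl | rfl | rfl | ⟨h1, h2, h3, h4, h5, h6, h7, -⟩ := hpos e <;> clear hpos <;>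
      simp_all [ne_of_gt, Function.update_apply] <;> grind
  · have key : ∀ {g₁ φ : Fin k → N}, g₁ = φ → f g₁ + 0 + 0 - 0 - 0 = f φ := by
      rintro _ _ rfl
      ring
    simp only [if_neg hd', if_neg hc']
    refine key ?_ <;> funext e <;>
      obtain rfl | rfl | rfl | ⟨h1, h2, h3, h4, h5, h6, h7, -⟩ := hpos e <;> clear hpos <;>
      simp_all [le_of_lt] <;> grind

/-- The term `s L s` has the right substitution for each `m` except that it keeps the value at `c`.
If `x c ≠ x d`, this matters only for `m = x c`, where `s L pHalf` cancels the wrong summand and σ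
supplies the right one. If `x c = x d`, the terms `s L s` and `pHalf L s` cancel, as do σ and `s L
pHalf`, and `pHalf L p pHalf` is the whole answer. -/
theorem actsAsL_succ {j : ℕ} (hL : ActsAsL N (j + 1) (L k (j + 1)))
    (hs : ActsAsSigma N (j + 1) (sigma k (j + 2))) : ActsAsL N (j + 2) (L k (j + 2)) := by
  intro d hd f x
  obtain ⟨c, hc⟩ : ∃ c : Fin k, c.val = j := ⟨⟨j, by omega⟩, rfl⟩
  have s1 := act_s (N := N) (i := j + 1) (c := c) (d := d) (by omega) (by omega)
  have h1 := act_pHalf (N := N) (i := j + 1) (c := c) (d := d) (by omega) (by omega)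
  have p2 := act_p (N := N) (i := j + 2) (c := d) (by omega)
  have l1 := hL c (by omega)
  have sg := hs c d (by omega) (by omega)
  have hcd : c < d := by rw [Fin.lt_def]; omega
  have hpos : ∀ e : Fin k, e = c ∨ e = d ∨ (Equiv.swap c d e = e ∧ e ≠ c ∧ e ≠ d ∧
      (e ≤ d ↔ e ≤ c)) := by
    intro e
    by_cases h1 : e = c
    · exact Or.inl h1
    by_cases h2 : e = d
    · exact Or.inr (Or.inl h2)
    refine Or.inr (Or.inr ⟨Equiv.swap_apply_of_ne_of_ne h1 h2, h1, h2, ?_⟩)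
    simp only [Fin.ext_iff, Fin.le_def] at *
    omega
  rw [L_succ k (j + 1) (by omega)]
  simp only [act_add, act_sub, act_neg, act_mul, s1, h1, p2, l1, sg]
  clear s1 h1 p2 l1 sg hL hs
  simp only [Function.comp_apply, Equiv.swap_apply_left, Equiv.swap_apply_right, le_refl,
    hcd.not_ge, hcd.ne, if_true, if_false, Finset.sum_ite_eq', Finset.sum_ite_eq, Finset.mem_univ,
    Function.update_self, Function.update_of_ne, ne_eq, not_false_eq_true]
  by_cases hx : x c = x d
  · have key : ∀ {g₁ g₅ : Fin k → N} {g₂ g₃ g₄ φ : N → Fin k → N}, g₁ = g₅ →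
        (∀ m, g₂ m = g₄ m) → (∀ m, g₃ m = φ m) →
        -f g₁ - ∑ m, f (g₂ m) + ∑ m, f (g₃ m) + ∑ m, f (g₄ m) + f g₅ = ∑ m, f (φ m) := by
      intro g₁ g₅ g₂ g₃ g₄ φ h h' h''
      obtain rfl := h
      obtain rfl := funext h'
      obtain rfl := funext h''
      ring
    simp only [if_pos hx]
    refine key (funext fun e => ?_) (fun m => funext fun e => ?_) (fun m => funext fun e => ?_) <;>
      obtain rfl | rfl | ⟨h1, h2, h3, h4⟩ := hpos e <;> clear hpos <;>
      simp_all [le_of_lt, Function.update_apply]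
  · have key : ∀ {g₁ g₅ : Fin k → N} {g₄ φ : N → Fin k → N}, g₁ = g₄ (x c) → g₅ = φ (x c) →
        (∀ m, m ≠ x c → g₄ m = φ m) →
        -f g₁ - 0 + 0 + ∑ m, f (g₄ m) + f g₅ = ∑ m, f (φ m) := by
      rintro _ _ g₄ φ rfl rfl h
      -- Split off the exceptional summand `m = x c` on both sides.
      rw [← Finset.add_sum_erase _ _ (Finset.mem_univ (x c)),
        ← Finset.add_sum_erase _ (fun m => f (φ m)) (Finset.mem_univ (x c)),
        Finset.sum_congr rfl fun m hm => congrArg f (h m (Finset.ne_of_mem_erase hm))]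
      ring
    simp only [if_neg hx]
    refine key (funext fun e => ?_) (funext fun e => ?_) (fun m hm => funext fun e => ?_)
    · obtain rfl | rfl | ⟨h1, h2, h3, h4⟩ := hpos e
      · simp [hcd.not_ge]
      · simp [hcd.not_ge]
      · simp [h1]
    · obtain rfl | rfl | ⟨h1, h2, h3, h4⟩ := hpos e
      · simp [hcd.le]
      · simp
      · simp [h4]
    · obtain rfl | rfl | ⟨h1, h2, h3, h4⟩ := hpos e
      · simp [hcd.le, hcd.not_ge, Equiv.swap_apply_of_ne_of_ne hm.symm hx]
      · simp
      · simp [h1, h4]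

/-- The index of σ runs one ahead of that of `L`, since `L_{j+1}` and `σ_{j+2}` together determine
both `L_{j+2}` and `σ_{j+3}`. -/
theorem actsAsL_and_actsAsSigma (j : ℕ) :
    ActsAsL N (j + 1) (L k (j + 1)) ∧ ActsAsSigma N (j + 1) (sigma k (j + 2)) := by
  induction j with
  | zero =>
    constructor
    · intro c hc f x
      rw [L_one, act_p hc]
      refine Finset.sum_congr rfl fun m _ => congrArg f (funext fun e => ?_)
      by_cases he : e = c
      · simp [he]
      · have : ¬ e ≤ c := fun h => he (Fin.ext (by rw [Fin.le_def] at h; omega))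
        simp [he, this]
    · intro c d hc hd f x
      rw [sigma_two, act_s hc hd]
      refine congrArg f (funext fun e => ?_)
      by_cases h1 : e = c
      · have : c ≤ d := by rw [Fin.le_def]; omega
        simp [h1, this]
      by_cases h2 : e = d
      · simp [h2]
      have : ¬ e ≤ d := fun h => by
        simp only [Fin.ext_iff, Fin.le_def] at *
        omega
      simp [this, Equiv.swap_apply_of_ne_of_ne h1 h2]
  | succ j ih => exact ⟨actsAsL_succ ih.1 ih.2, actsAsSigma_succ ih.1 ih.2⟩

theorem actsAsSigmaHalf (j : ℕ) : ActsAsSigmaHalf N (j + 1) (sigmaHalf k (j + 1)) := by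
  induction j with
  | zero =>
    intro c d hc hd f x
    rw [sigmaHalf, act_one]
    refine congrArg f (funext fun e => ?_)
    -- For `i = 1` the range of affected variables is empty, so the operator is the identity.
    have : ¬ e < c := fun h => by rw [Fin.lt_def] at h; omega
    simp [this]
  | succ j ih => exact actsAsSigmaHalf_succ (actsAsL_and_actsAsSigma j).1 ih

end ClosedForms

/-! ### Commutation of value exchanges with generators -/

section Commutation

variable {k : ℕ} {i : ℕ} {a b c d : Fin k} {t : PartitionAlgebra k} {P : Fin k → Prop}
  [DecidablePred P]

/-- If `t` exchanges two values in the variables selected by `P`, then it commutes with the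
generators that only involve selected variables other than the two that hold these values. -/
theorem commute_s (ht : ∀ (n : ℕ) (f : (Fin k → Fin n) → ℤ) (x : Fin k → Fin n),
      act t f x = f fun e => if P e then Equiv.swap (x c) (x d) (x e) else x e)
    (ha : a.val + 1 = i) (hb : b.val = i) (hPa : P a) (hPb : P b) (hac : a ≠ c) (had : a ≠ d)
    (hbc : b ≠ c) (hbd : b ≠ d) : t * s k i = s k i * t := by
  refine eq_of_act fun n f x => ?_
  rw [act_mul, act_mul, ht, act_s ha hb, act_s ha hb, ht]
  refine congrArg f (funext fun e => ?_)
  have hc : Equiv.swap a b c = c := Equiv.swap_apply_of_ne_of_ne hac.symm hbc.symm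
  have hd : Equiv.swap a b d = d := Equiv.swap_apply_of_ne_of_ne had.symm hbd.symm
  simp only [Function.comp_apply, hc, hd]
  have : P (Equiv.swap a b e) ↔ P e := by
    rw [Equiv.swap_apply_def]
    split_ifs with h1 h2
    · rw [h1]; exact iff_of_true hPb hPa
    · rw [h2]; exact iff_of_true hPa hPb
    · rfl
  simp only [this]

/-- A permutation of values preserves whether two affected variables agree. The variables need not
avoid `c` and `d`, which allows the overlapping pair `i-1`, `i`. -/
theorem commute_pHalf (ht : ∀ (n : ℕ) (f : (Fin k → Fin n) → ℤ) (x : Fin k → Fin n),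
      act t f x = f fun e => if P e then Equiv.swap (x c) (x d) (x e) else x e)
    (ha : a.val + 1 = i) (hb : b.val = i) (hPa : P a) (hPb : P b) :
    t * pHalf k i = pHalf k i * t := by
  refine eq_of_act fun n f x => ?_
  rw [act_mul, act_mul, ht, act_pHalf ha hb, act_pHalf ha hb, ht]
  simp [hPa, hPb]

theorem commute_p (ht : ∀ (n : ℕ) (f : (Fin k → Fin n) → ℤ) (x : Fin k → Fin n),
      act t f x = f fun e => if P e then Equiv.swap (x c) (x d) (x e) else x e)
    (ha : a.val + 1 = i) (hPa : P a) (hac : a ≠ c) (had : a ≠ d) :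
    t * p k i = p k i * t := by
  refine eq_of_act fun n f x => ?_
  rw [act_mul, act_mul, ht, act_p ha, act_p ha]
  -- The summed value at `a` is itself exchanged by `t`, so the two sums differ by this relabelling.
  refine Fintype.sum_equiv (Equiv.swap (x c) (x d)) _ _ fun m => ?_
  rw [ht]
  refine congrArg f (funext fun e => ?_)
  rw [Function.update_of_ne hac.symm, Function.update_of_ne had.symm]
  by_cases he : e = a
  · subst he
    simp [hPa]
  · simp [he]

end Commutation

/-! ### The two product formulas and the final assembly -/

/-- Both sides vanish unless `x b = x c`. In that case the last `pHalf` pins the sum in `L` to `m =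
x d`, and exchanging `x d` with `x b` is exchanging `x d` with `x c`. -/
theorem pHalf_mul_sigma (k j : ℕ) (hk : j + 3 ≤ k) :
    pHalf k (j + 1) * sigma k (j + 3) =
      pHalf k (j + 1) * L k (j + 1) * s k (j + 2) * pHalf k (j + 1) := by
  refine eq_of_act fun n f x => ?_
  obtain ⟨b, hb⟩ : ∃ b : Fin k, b.val = j := ⟨⟨j, by omega⟩, rfl⟩
  obtain ⟨c, hc⟩ : ∃ c : Fin k, c.val = j + 1 := ⟨⟨j + 1, by omega⟩, rfl⟩
  obtain ⟨d, hd⟩ : ∃ d : Fin k, d.val = j + 2 := ⟨⟨j + 2, by omega⟩, rfl⟩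
  have s2 := act_s (N := Fin n) (i := j + 2) (c := c) (d := d) (by omega) (by omega)
  have h1 := act_pHalf (N := Fin n) (i := j + 1) (c := b) (d := c) (by omega) (by omega)
  have l1 := (actsAsL_and_actsAsSigma (k := k) (N := Fin n) j).1 b (by omega)
  have sg := (actsAsL_and_actsAsSigma (k := k) (N := Fin n) (j + 1)).2 c d (by omega) (by omega)
  have hpos := eq_or_apart (b := b) (c := c) (d := d) (by omega) (by omega)
  have hbc : b < c := by rw [Fin.lt_def]; omega
  have hcd : c < d := by rw [Fin.lt_def]; omega
  have hbd := hbc.trans hcd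
  have e1 : Equiv.swap c d b = b := Equiv.swap_apply_of_ne_of_ne hbc.ne hbd.ne
  simp only [act_mul, s2, h1, l1, sg]
  simp only [Function.comp_apply, e1, Equiv.swap_apply_left, Equiv.swap_apply_right, le_refl,
    hbd.not_ge, if_true, if_false, Finset.sum_ite_eq', Finset.mem_univ]
  clear s2 h1 l1 sg
  by_cases hx : x b = x c
  · simp only [if_pos hx]
    refine congrArg f (funext fun e => ?_)
    obtain rfl | rfl | rfl | ⟨h1, h2, h3, h4, h5, h6, h7, -⟩ := hpos e <;> clear hpos <;>
      simp_all [le_of_lt] <;> grind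
  · simp only [if_neg hx]

/-- Conjugation by the transpositions turns the exchange by `σ_i` into one of `x c` and `x d` that
skips `b`, and moves the summed variable to `b`. On the left the summed value is exchanged as well,
which only permutes the summands. -/
theorem p_mul_sigma (k j : ℕ) (hk : j + 3 ≤ k) :
    p k (j + 1) * sigma k (j + 3) =
      s k (j + 1) * s k (j + 2) * sigma k (j + 2) * p k (j + 3) * s k (j + 2) * s k (j + 1) := by
  refine eq_of_act fun n f x => ?_
  obtain ⟨b, hb⟩ : ∃ b : Fin k, b.val = j := ⟨⟨j, by omega⟩, rfl⟩
  obtain ⟨c, hc⟩ : ∃ c : Fin k, c.val = j + 1 := ⟨⟨j + 1, by omega⟩, rfl⟩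
  obtain ⟨d, hd⟩ : ∃ d : Fin k, d.val = j + 2 := ⟨⟨j + 2, by omega⟩, rfl⟩
  have s1 := act_s (N := Fin n) (i := j + 1) (c := b) (d := c) (by omega) (by omega)
  have s2 := act_s (N := Fin n) (i := j + 2) (c := c) (d := d) (by omega) (by omega)
  have p1 := act_p (N := Fin n) (i := j + 1) (c := b) (by omega)
  have p3 := act_p (N := Fin n) (i := j + 3) (c := d) (by omega)
  have sg1 := (actsAsL_and_actsAsSigma (k := k) (N := Fin n) j).2 b c (by omega) (by omega)
  have sg := (actsAsL_and_actsAsSigma (k := k) (N := Fin n) (j + 1)).2 c d (by omega) (by omega)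
  have hpos := eq_or_apart (b := b) (c := c) (d := d) (by omega) (by omega)
  have hbc : b < c := by rw [Fin.lt_def]; omega
  have hcd : c < d := by rw [Fin.lt_def]; omega
  have hbd := hbc.trans hcd
  have e1 : Equiv.swap c d b = b := Equiv.swap_apply_of_ne_of_ne hbc.ne hbd.ne
  have e2 : Equiv.swap b c d = d := Equiv.swap_apply_of_ne_of_ne hbd.ne' hcd.ne'
  simp only [act_mul, s1, s2, p1, p3, sg1, sg]
  clear s1 s2 p1 p3 sg1 sg
  refine Fintype.sum_equiv (Equiv.swap (x c) (x d)) _ _ fun m => congrArg f (funext fun e => ?_)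
  obtain rfl | rfl | rfl | ⟨h1, h2, h3, h4, h5, h6, h7, -⟩ := hpos e <;> clear hpos <;>
    simp_all [le_of_lt, ne_of_gt, Function.update_apply] <;> grind

end PartitionAlg

open PartitionAlg in
theorem mainTheorem6 (k i : ℕ) (hi : 2 ≤ i) (hk : i + 1 ≤ k) :
    (sigma k (i + 1) * pHalf k (i - 1) = pHalf k (i - 1) * sigma k (i + 1) ∧
      pHalf k (i - 1) * sigma k (i + 1) =
        pHalf k (i - 1) * L k (i - 1) * s k i * pHalf k (i - 1)) ∧
    (sigma k (i + 1) * p k (i - 1) = p k (i - 1) * sigma k (i + 1) ∧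
      p k (i - 1) * sigma k (i + 1) =
        s k (i - 1) * s k i * sigma k i * p k (i + 1) * s k i * s k (i - 1)) ∧
    (3 ≤ i → sigma k (i + 1) * pHalf k (i - 2) = pHalf k (i - 2) * sigma k (i + 1)) ∧
    (3 ≤ i → sigma k (i + 1) * s k (i - 2) = s k (i - 2) * sigma k (i + 1)) ∧
    (3 ≤ i → sigma k (i + 1) * p k (i - 2) = p k (i - 2) * sigma k (i + 1)) ∧
    sigmaHalf k i * p k (i - 1) = p k (i - 1) * sigmaHalf k i ∧
    (3 ≤ i → sigmaHalf k i * pHalf k (i - 2) = pHalf k (i - 2) * sigmaHalf k i) ∧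
    (3 ≤ i → sigmaHalf k i * s k (i - 2) = s k (i - 2) * sigmaHalf k i) ∧
    (3 ≤ i → sigmaHalf k i * p k (i - 2) = p k (i - 2) * sigmaHalf k i) := by
  obtain ⟨j, rfl⟩ : ∃ j, i = j + 2 := ⟨i - 2, by omega⟩
  simp only [Nat.add_succ_sub_one, Nat.add_sub_cancel]
  let c : Fin k := ⟨j + 1, by omega⟩
  let d : Fin k := ⟨j + 2, by omega⟩
  let b : Fin k := ⟨j, by omega⟩
  have hσ := fun n => (actsAsL_and_actsAsSigma (k := k) (N := Fin n) (j + 1)).2 c d rfl rfl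
  have hh := fun n => actsAsSigmaHalf (k := k) (N := Fin n) (j + 1) c d rfl rfl
  have ne : ∀ u v : Fin k, u.val ≠ v.val → u ≠ v := fun u v h => mt (congrArg Fin.val) h
  have hbc : b ≠ c := ne _ _ (by simp [b, c])
  have hbd : b ≠ d := ne _ _ (by simp [b, d])
  have hb_le : b ≤ d := by simp [Fin.le_def, b, d]
  have hb_lt : b < c := by simp [Fin.lt_def, b, c]
  have hc_le : c ≤ d := by simp [Fin.le_def, c, d]
  refine ⟨⟨commute_pHalf (a := b) (b := c) hσ rfl rfl hb_le hc_le, pHalf_mul_sigma k j (by omega)⟩,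
    ⟨commute_p (a := b) hσ rfl hb_le hbc hbd, p_mul_sigma k j (by omega)⟩, ?_⟩
  -- Brings forward relation 6, the only remaining one that does not assume `3 ≤ i`.
  rw [← and_assoc, ← and_assoc, and_left_comm]
  refine ⟨commute_p (a := b) hh rfl hb_lt hbc hbd, ?_⟩
  rw [and_assoc, and_assoc, ← forall_and, ← forall_and, ← forall_and, ← forall_and, ← forall_and]
  intro hj
  -- The variable `i-2`; the assumption `3 ≤ i` gives `1 ≤ j`, so the subtraction is not truncated.
  let a : Fin k := ⟨j - 1, by omega⟩
  have ha : a.val + 1 = j := Nat.sub_add_cancel (by omega)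
  have hac : a ≠ c := ne _ _ (by simp only [c]; omega)
  have had : a ≠ d := ne _ _ (by simp only [d]; omega)
  have ha_le : a ≤ d := by rw [Fin.le_def]; simp only [d]; omega
  have ha_lt : a < c := by rw [Fin.lt_def]; simp only [c]; omega
  exact ⟨commute_pHalf (b := b) hσ ha rfl ha_le hb_le,
    commute_s (b := b) hσ ha rfl ha_le hb_le hac had hbc hbd,
    commute_p hσ ha ha_le hac had,
    commute_pHalf (b := b) hh ha rfl ha_lt hb_lt,
    commute_s (b := b) hh ha rfl ha_lt hb_lt hac had hbc hbd,
    commute_p hh ha ha_lt hac had⟩
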